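/- Let $G=(V,E)$ be a finite connected undirected multigraph (parallel edges allowed), $n=|V|$. A demand is a function $d:V\times V\to\mathbb R_{\ge 0}$ with $d(v,v)=0$ for all $v$; it is a $\{0,1\}$-demand if all its values lie in $\{0,1\}$. An oblivious routing $R$ assigns to every pair $(s,t)\in V\times V$ a probability distribution $R(s,t)$ on the simple paths from $s$ to $t$. Its congestion on $d$ is $$\mathrm{cong}(R,d)=\max_{e\in E}\ \sum_{s,t} d(s,t)\,\Pr[e\in R(s,t)]$$ (and $0$ if $E=\emptyset$). A path system $\mathcal P$ assigns to every pair $(s,t)$ a set $P(s,t)$ of simple paths from $s$ to $t$, and $\mathrm{cong}_{\mathbb R}(\mathcal P,d)$ is the minimum of $\mathrm{cong}(R',d)$ over all routings $R'$ such that $R'(s,t)$ is supported on $P(s,t)$ for all $(s,t)$. For a positive integer $\alpha$, an $\alpha$-sample of $R$ is the random path system $\mathcal P$ in which $P(s,t)$ is the set of $\alpha$ paths drawn with replacement from $R(s,t)$, all draws, for all pairs, being independent. **Corollary ($\alpha$-sample corollary).** For all nonnegative integers $K,k$ and every real $C>0$ there are constants $A,B>0$, depending only on $K,k,C$, such that the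 following holds. Let $G$ be a finite connected multigraph with $n$ vertices and at most $K n^k$ edges, let $R$ be an oblivious routing on $G$, let $\alpha\in\{1,\dots,n\}$, and let $\mathcal P$ be an $\alpha$-sample of $R$. Then with probability at least $1-n^{-C}$ both of the following hold: for every demand $d$, $$\mathrm{cong}_{\mathbb R}(\mathcal P,d)\le A\,\log_2^2(n)\,\bigl(\alpha+n^{B/\alpha}\bigr)\,\Bigl(\mathrm{cong}(R,d)+\max_{s,t}d(s,t)\Bigr),$$ and for every $\{0,1\}$-demand $d$, $$\mathrm{cong}_{\mathbb R}(\mathcal P,d)\le A\,\log_2(n)\,\bigl(\alpha+n^{B/\alpha}\bigr)\,\bigl(\mathrm{cong}(R,d)+1\bigr).$$ -/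

import Mathlib

open MeasureTheory
open scoped Graph ENNReal

noncomputable section

namespace Graph

/-- Walks in a multigraph `G` (parallel edges are distinguished from each other). -/
inductive Walk {V E : Type*} (G : Graph V E) : V → V → Type _
  | nil {u : V} (hu : u ∈ V(G)) : Walk G u u
  | cons {u v w : V} (e : E) (h : G.IsLink e u v) (p : Walk G v w) : Walk G u w

namespace Walk

variable {V E : Type*} {G : Graph V E}

/-- The list of vertices visited by a walk. -/
def support : {u v : V} → G.Walk u v → List V
  | u, _, nil _ => [u]
  | u, _, cons _ _ p => u :: p.support

/-- The list of edges traversed by a walk. -/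
def edges : {u v : V} → G.Walk u v → List E
  | _, _, nil _ => []
  | _, _, cons e _ p => e :: p.edges

end Walk

variable {V E : Type*}

/-- `G` has a vertex, and any two of its vertices are joined by a walk. -/
def IsConnected (G : Graph V E) : Prop :=
  V(G).Nonempty ∧ ∀ s ∈ V(G), ∀ t ∈ V(G), Nonempty (G.Walk s t)

/-- Simple paths from `s` to `t`: walks that visit no vertex twice. -/
def SimplePath (G : Graph V E) (s t : V) : Type _ :=
  {p : G.Walk s t // p.support.Nodup}

/-- The simple path `p` uses the edge `e`. -/
def SimplePath.Uses {G : Graph V E} {s t : V} (p : G.SimplePath s t) (e : E) : Prop :=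
  e ∈ p.1.edges

/-- The sets of simple paths carry the discrete `σ`-algebra. -/
instance (G : Graph V E) (s t : V) : MeasurableSpace (G.SimplePath s t) := ⊤

/-- A demand: nonnegative numbers `d s t` for all pairs of vertices, zero on the diagonal. -/
structure Demand (G : Graph V E) where
  val : V(G) → V(G) → ℝ
  nonneg : ∀ s t, 0 ≤ val s t
  diag : ∀ v, val v v = 0

/-- A demand all of whose values are `0` or `1`. -/
def Demand.IsZeroOne {G : Graph V E} (d : G.Demand) : Prop :=
  ∀ s t, d.val s t = 0 ∨ d.val s t = 1

/-- The largest entry `max_{s,t} d(s,t)` of a demand. -/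
def Demand.maxEntry {G : Graph V E} (d : G.Demand) : ℝ :=
  ⨆ st : V(G) × V(G), d.val st.1 st.2

/-- A path system (semi-oblivious routing): a set of simple paths from `s` to `t`
for every pair of vertices. -/
def PathSystem (G : Graph V E) : Type _ :=
  ∀ s t : V(G), Set (G.SimplePath s t)

/-- A routing (oblivious routing): a probability distribution on the simple paths
from `s` to `t` for every pair of vertices. -/
def Routing (G : Graph V E) : Type _ :=
  ∀ s t : V(G), PMF (G.SimplePath s t)

namespace Routing

variable {G : Graph V E}

/-- The routing `R` is supported on the path system `P`. -/
def SupportedOn (R : G.Routing) (P : G.PathSystem) : Prop :=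
  ∀ s t, (R s t).support ⊆ P s t

/-- The probability that the random path `R(s,t)` uses the edge `e`. -/
def probUses (R : G.Routing) (s t : V(G)) (e : E) : ℝ :=
  (R s t).toMeasure.real {p | p.Uses e}

/-- The congestion of an edge: `∑_{s,t} d(s,t) · Pr[e ∈ R(s,t)]`. -/
def edgeCong [Fintype V(G)] (R : G.Routing) (d : G.Demand) (e : E) : ℝ :=
  ∑ s, ∑ t, d.val s t * R.probUses s t e

/-- The congestion of a routing on a demand: the maximum over the edges of `G` of the
congestion of the edge (`0` if there are no edges). -/
def cong [Fintype V(G)] (R : G.Routing) (d : G.Demand) : ℝ :=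
  ⨆ e : E(G), R.edgeCong d e

/-- The possible outcomes of drawing `α` paths from `s` to `t` for every pair `(s, t)`;
the path drawn at the index `(s, t, i)` is the `i`-th path for the pair `(s, t)`. -/
abbrev SampleSpace (G : Graph V E) (α : ℕ) : Type _ :=
  ∀ i : V(G) × V(G) × Fin α, G.SimplePath i.1 i.2.1

/-- The law of the draws: all of them are independent, and each path for the pair `(s, t)`
has the law `R(s,t)`. -/
def sampleLaw [Fintype V(G)] (R : G.Routing) (α : ℕ) : Measure (SampleSpace G α) :=
  Measure.pi fun i => (R i.1 i.2.1).toMeasure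

end Routing

variable {G : Graph V E}

namespace PathSystem

/-- The path system that consists of the drawn paths. -/
def ofSample {α : ℕ} (ω : Routing.SampleSpace G α) : G.PathSystem :=
  fun s t => Set.range fun i : Fin α => ω (s, t, i)

/-- The congestion of fractionally routing `d` via the path system `P`: the least congestion
of a routing supported on `P` (`∞` if there is no such routing). -/
def cong [Fintype V(G)] (P : G.PathSystem) (d : G.Demand) : ℝ≥0∞ :=
  ⨅ (R : G.Routing) (_ : R.SupportedOn P), ENNReal.ofReal (R.cong d)

end PathSystem

end Graph

end

/-! Call a sample good (`SampleGood`) if no small edge set `F`, lightly loaded by `R` under unit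
demand on a set `S` of pairs, is hit by half of the draws for `S`. Light load means that the
expected number of hits is at most `α|S|/θ²`, so Chernoff bounds the failure probability for fixed
`S`, `F` by `(e/θ)^(α|S|)`. Since `|F| ≤ |S|`, the choices of `F` cost `(|E|+1)^|S|`; the choices of
`S` cost about `n²` per pair. Taking `θ = e·n^(b/α)` pays for both (`sampleLaw_not_sampleGood_le`).

The rest is deterministic. If unit demand on `S` loads every edge by at most `c`, collect greedily a
set `F` of edges that the draws overload. It is too small to be hit by half of the draws, so a third
of the pairs keep a quarter of their draws, and spreading these pairs uniformly over the kept draws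
costs `4θ²c` (`SampleGood.exists_third_routable`). Repeating on the remaining pairs takes `O(log n)`
rounds, which settles `{0,1}`-demands. General demands split into `O(log n)` dyadic weight classes,
whence the second logarithm. -/

section

open scoped Classical

/-! ### Probabilistic and counting tools. -/

/-- A Chernoff bound for the number of independent coordinates that hit prescribed sets. -/
theorem measureReal_pi_card_le_two_mul_hits_le {ι : Type*} [Fintype ι]
    {Ω : ι → Type*} [∀ i, MeasurableSpace (Ω i)] (μ : ∀ i, Measure (Ω i))
    [∀ i, IsProbabilityMeasure (μ i)] (H : ∀ i, Set (Ω i)) (hH : ∀ i, MeasurableSet (H i))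
    (J : Finset ι) {θ : ℝ} (hθ : 1 ≤ θ) :
    (Measure.pi μ).real {ω | J.card ≤ 2 * (J.filter fun j => ω j ∈ H j).card} ≤
      Real.exp (θ ^ 2 * ∑ j ∈ J, (μ j).real (H j)) / θ ^ J.card := by
  -- Each hit in `J` contributes a factor `θ²`, so the product is `θ^(2·hits)` and Markov applies at
  -- the threshold `θ^|J|`.
  let f : ∀ i, Ω i → ℝ := fun i x =>
    1 + (if i ∈ J then (H i).indicator (fun _ => θ ^ 2 - 1) x else 0)
  have hθ2 : 0 ≤ θ ^ 2 - 1 := by nlinarith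
  have hf1 : ∀ i x, 1 ≤ f i x := by
    intro i x
    simp only [f]
    split_ifs
    · have := Set.indicator_nonneg (s := H i) (f := fun _ => θ ^ 2 - 1) (fun _ _ => hθ2) x
      linarith
    · simp
  have hint : ∀ i, Integrable (f i) (μ i) := by
    intro i
    by_cases hi : i ∈ J
    · simp only [f, hi, if_true]
      exact (integrable_const _).add ((integrable_const _).indicator (hH i))
    · simp only [f, hi, if_false]
      exact integrable_const _
  have hval : ∀ ω : ∀ i, Ω i, ∏ i, f i (ω i) = (θ ^ 2) ^ {j ∈ J | ω j ∈ H j}.card := by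
    intro ω
    rw [← Finset.prod_const, Finset.prod_filter,
      ← Finset.prod_subset (Finset.subset_univ J)]
    · refine Finset.prod_congr rfl fun j hj => ?_
      by_cases h : ω j ∈ H j <;> simp [f, hj, h]
    · intro j _ hj
      simp [f, hj]
  have hmarkov := mul_meas_ge_le_integral_of_nonneg (μ := Measure.pi μ)
    (f := fun ω => ∏ i, f i (ω i))
    (Filter.Eventually.of_forall fun ω => Finset.prod_nonneg fun i _ => by linarith [hf1 i (ω i)])
    (Integrable.fintype_prod_dep hint) (θ ^ J.card)
  rw [integral_fintype_prod_eq_prod (fun i x => f i x)] at hmarkov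
  have hpos : 0 < θ ^ J.card := by positivity
  rw [le_div_iff₀ hpos, mul_comm]
  have hsub : {ω : ∀ i, Ω i | J.card ≤ 2 * {j ∈ J | ω j ∈ H j}.card} ⊆
      {ω | θ ^ J.card ≤ ∏ i, f i (ω i)} := by
    intro ω hω
    simp only [Set.mem_ofPred_eq] at hω ⊢
    rw [hval, ← pow_mul]
    exact pow_le_pow_right₀ hθ hω
  refine (mul_le_mul_of_nonneg_left (measureReal_mono hsub) hpos.le).trans (hmarkov.trans ?_)
  rw [← Finset.prod_subset (Finset.subset_univ J), Finset.mul_sum, Real.exp_sum]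
  · refine Finset.prod_le_prod (fun i _ => integral_nonneg fun x => zero_le_one.trans (hf1 i x)) ?_
    intro j hj
    simp only [f, hj, if_true]
    rw [integral_add (integrable_const _) ((integrable_const _).indicator (hH j)),
      integral_indicator_const _ (hH j)]
    simp only [integral_const, probReal_univ, smul_eq_mul]
    have := Real.add_one_le_exp (θ ^ 2 * (μ j).real (H j))
    nlinarith [measureReal_nonneg (μ := μ j) (s := H j)]
  · intro j _ hj
    simp [f, hj]

/-- Greedy choice of overloaded sets: outside of them every set is hit fewer than `τ` times. -/
theorem exists_overloaded_finset {ι X : Type*} [Fintype X] (J : Finset ι)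
    (U : ι → X → Prop) {τ : ℝ} (hτ : 0 < τ) :
    ∃ F : Finset X, τ * F.card ≤ {j ∈ J | ∃ e ∈ F, U j e}.card ∧
      ∀ e, ({j ∈ J | (¬ ∃ e ∈ F, U j e) ∧ U j e}.card : ℝ) < τ := by
  let p : Finset X → Prop := fun F => τ * F.card ≤ {j ∈ J | ∃ e ∈ F, U j e}.card
  -- A largest `F` works: an element with at least `τ` hits not already counted for `F` could be
  -- inserted.
  obtain ⟨F, hF, hmax⟩ := Finset.exists_max_image (Finset.univ.filter p) Finset.card
    ⟨∅, by simp [p]⟩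
  have hF' : p F := (Finset.mem_filter.1 hF).2
  refine ⟨F, hF', fun e => ?_⟩
  by_cases he : e ∈ F
  · have : {j ∈ J | (¬ ∃ e ∈ F, U j e) ∧ U j e} = ∅ := by
      ext j
      simp only [Finset.mem_filter, Finset.notMem_empty, iff_false]
      rintro ⟨-, h, hu⟩
      exact h ⟨e, he, hu⟩
    rw [this]
    simpa using hτ
  · by_contra h
    rw [not_lt] at h
    have hp : p (insert e F) := by
      have h2 : {j ∈ J | ∃ e' ∈ insert e F, U j e'} =
          {j ∈ J | ∃ e ∈ F, U j e} ∪ {j ∈ J | (¬ ∃ e ∈ F, U j e) ∧ U j e} := by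
        ext j
        simp only [Finset.mem_insert, exists_eq_or_imp, Finset.mem_filter, Finset.mem_union]
        generalize (∃ a ∈ F, U j a) = q
        tauto
      simp only [p]
      rw [h2, Finset.card_union_of_disjoint, Finset.card_insert_of_notMem he]
      · push_cast
        simp only [p] at hF'
        linarith
      · rw [Finset.disjoint_left]
        intro j h3 h4
        exact (Finset.mem_filter.1 h4).2.1 (Finset.mem_filter.1 h3).2
    have := hmax _ (Finset.mem_filter.2 ⟨Finset.mem_univ _, hp⟩)
    rw [Finset.card_insert_of_notMem he] at this
    omega

/-- Such a set is the range of a function `Fin D → Option X`, with `none` as padding. -/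
theorem card_finset_card_le {X : Type*} [Fintype X] (D : ℕ) :
    (Finset.univ.filter fun F : Finset X => F.card ≤ D).card ≤ (Fintype.card X + 1) ^ D := by
  have h : (Finset.univ.filter fun F : Finset X => F.card ≤ D) ⊆
      Finset.univ.image fun g : Fin D → Option X => Finset.univ.filter fun x => ∃ i, g i = some x := by
    intro F hF
    have hF : F.card ≤ D := (Finset.mem_filter.1 hF).2
    simp only [Finset.mem_image, Finset.mem_univ, true_and]
    refine ⟨fun i => if h : i.1 < F.card then some (F.equivFin.symm ⟨i, h⟩).1 else none, ?_⟩
    ext x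
    simp only [Finset.mem_filter, Finset.mem_univ, true_and]
    constructor
    · rintro ⟨i, hi⟩
      split_ifs at hi with h
      · simp only [Option.some.injEq] at hi
        exact hi ▸ (F.equivFin.symm ⟨i, h⟩).2
    · intro hx
      refine ⟨⟨F.equivFin ⟨x, hx⟩, (F.equivFin ⟨x, hx⟩).2.trans_le hF⟩, ?_⟩
      simp
  refine (Finset.card_le_card h).trans (Finset.card_image_le.trans ?_)
  simp

/-- With `N` the size of `ι`, the sum is `(1+r)^N - 1 ≤ exp(Nr) - 1`. It drives the union bound over
sets of pairs. -/
theorem sum_pow_card_filter_nonempty_le {ι : Type*} [Fintype ι] {r : ℝ}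
    (hr : 0 ≤ r) (h : Fintype.card ι * r ≤ 1) :
    ∑ S : Finset ι with S.Nonempty, r ^ S.card ≤ 2 * (Fintype.card ι * r) := by
  have h1 := Fintype.sum_pow_mul_eq_add_pow ι r 1
  simp only [one_pow, mul_one] at h1
  have h2 : ∑ S : Finset ι, r ^ S.card = (∑ S : Finset ι with S.Nonempty, r ^ S.card) + 1 := by
    rw [← Finset.sum_filter_add_sum_filter_not Finset.univ (fun S : Finset ι => S.Nonempty)]
    congr 1
    simp only [Finset.not_nonempty_iff_eq_empty]
    rw [Finset.filter_eq' Finset.univ (∅ : Finset ι)]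
    simp
  have h3 : (r + 1) ^ Fintype.card ι ≤ Real.exp (Fintype.card ι * r) := by
    rw [mul_comm, Real.exp_mul, Real.rpow_natCast]
    exact pow_le_pow_left₀ (by linarith) (Real.add_one_le_exp r) _
  have h0 : 0 ≤ Fintype.card ι * r := by positivity
  have h4 := Real.abs_exp_sub_one_le (x := Fintype.card ι * r) (by rwa [abs_of_nonneg h0])
  rw [abs_of_nonneg h0] at h4
  have := le_abs_self (Real.exp (Fintype.card ι * r) - 1)
  linarith

/-! ### A sample is good with high probability. -/

namespace Graph

variable {V E : Type*} {G : Graph V E}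

/-- The indices of the draws for the pairs in `S`. -/
def draws (α : ℕ) (S : Finset (V(G) × V(G))) : Finset (V(G) × V(G) × Fin α) :=
  (S ×ˢ Finset.univ).map (Equiv.prodAssoc V(G) V(G) (Fin α)).toEmbedding

theorem card_draws (α : ℕ) (S : Finset (V(G) × V(G))) : (draws α S).card = S.card * α := by
  simp [draws]

theorem sum_draws {M : Type*} [AddCommMonoid M] {α : ℕ} (S : Finset (V(G) × V(G)))
    (g : V(G) × V(G) × Fin α → M) :
    ∑ j ∈ draws α S, g j = ∑ st ∈ S, ∑ i, g (st.1, st.2, i) := by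
  simp [draws, Finset.sum_product]

namespace Routing

/-- The congestion that `R` causes on `e` when each pair in `S` has unit demand. -/
noncomputable def load (R : G.Routing) (S : Finset (V(G) × V(G))) (e : E) : ℝ :=
  ∑ st ∈ S, R.probUses st.1 st.2 e

theorem probUses_nonneg (R : G.Routing) (s t : V(G)) (e : E) : 0 ≤ R.probUses s t e :=
  measureReal_nonneg

/-- No small set of edges that `R` loads lightly is hit by half of the draws for a set of
pairs. -/
def SampleGood (R : G.Routing) {α : ℕ} (θ : ℝ) (ω : SampleSpace G α) : Prop :=
  ∀ S : Finset (V(G) × V(G)), S.Nonempty → ∀ F : Finset E(G), F.card ≤ S.card →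
    θ ^ 2 * ∑ e ∈ F, R.load S e ≤ S.card →
      2 * ((draws α S).filter fun j => ∃ e ∈ F, (ω j).Uses (e : E)).card < (draws α S).card

theorem sampleLaw_hits_le [Fintype V(G)] (R : G.Routing) (α : ℕ) {θ : ℝ} (hθ : 1 ≤ θ)
    (S : Finset (V(G) × V(G))) (F : Finset E(G)) (hF : θ ^ 2 * ∑ e ∈ F, R.load S e ≤ S.card) :
    (R.sampleLaw α).real {ω : SampleSpace G α | (draws α S).card ≤
      2 * ((draws α S).filter fun j => ∃ e ∈ F, (ω j).Uses (e : E)).card} ≤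
      ((Real.exp 1 / θ) ^ α) ^ S.card := by
  have h := measureReal_pi_card_le_two_mul_hits_le
    (fun i : V(G) × V(G) × Fin α => (R i.1 i.2.1).toMeasure)
    (fun i => {p | ∃ e ∈ F, p.Uses (e : E)}) (fun i => trivial) (draws α S) hθ
  refine le_trans (le_of_eq ?_) (h.trans ?_)
  · unfold sampleLaw
    congr! 4
    simp only [Set.mem_ofPred_eq]
  rw [← pow_mul, mul_comm α, ← card_draws, div_pow, ← Real.exp_nat_mul, mul_one]
  gcongr
  have h1 : ∑ j ∈ draws α S,
      (R j.1 j.2.1).toMeasure.real {p | ∃ e ∈ F, p.Uses (e : E)} ≤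
      ∑ j ∈ draws α S, ∑ e ∈ F, R.probUses j.1 j.2.1 e := by
    refine Finset.sum_le_sum fun j _ => ?_
    have : {p : G.SimplePath j.1 j.2.1 | ∃ e ∈ F, p.Uses (e : E)} =
        ⋃ e ∈ F, {p | p.Uses (e : E)} := by
      ext; simp
    rw [this]
    exact measureReal_biUnion_finset_le _ _
  have h2 : ∑ j ∈ draws α S, ∑ e ∈ F, R.probUses j.1 j.2.1 e =
      α * ∑ e ∈ F, R.load S e := by
    rw [sum_draws]
    simp only [Finset.sum_const, Finset.card_univ, Fintype.card_fin, nsmul_eq_mul, load]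
    rw [← Finset.mul_sum, Finset.sum_comm]
  rw [h2] at h1
  have hθ2 : 0 ≤ θ ^ 2 := by positivity
  rw [card_draws]
  push_cast
  calc _ ≤ θ ^ 2 * (α * ∑ e ∈ F, R.load S e) := mul_le_mul_of_nonneg_left h1 hθ2
    _ = α * (θ ^ 2 * ∑ e ∈ F, R.load S e) := by ring
    _ ≤ α * S.card := by gcongr
    _ = _ := by ring

/-- For fixed `S` the union over `F` is absorbed into `r^|S|`, since each of at most `|S|` edges has
`|E|+1` choices. -/
theorem sampleLaw_not_sampleGood_le [Fintype V(G)] [Fintype E(G)] (R : G.Routing) (α : ℕ) {θ : ℝ}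
    (hθ : 1 ≤ θ) {r : ℝ} (hr : (Fintype.card E(G) + 1) * (Real.exp 1 / θ) ^ α ≤ r)
    (h : Fintype.card V(G) ^ 2 * r ≤ 1) :
    (R.sampleLaw α).real {ω : SampleSpace G α | ¬ R.SampleGood θ ω} ≤
      2 * (Fintype.card V(G) ^ 2 * r) := by
  have : IsProbabilityMeasure (R.sampleLaw α) := by unfold sampleLaw; infer_instance
  have h0 : 0 ≤ (Real.exp 1 / θ) ^ α := by positivity
  have hr0 : 0 ≤ r := le_trans (by positivity) hr
  let B : Finset (V(G) × V(G)) → Finset E(G) → Set (SampleSpace G α) := fun S F =>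
    {ω | (draws α S).card ≤
      2 * ((draws α S).filter fun j => ∃ e ∈ F, (ω j).Uses (e : E)).card}
  let Φ : Finset (V(G) × V(G)) → Finset (Finset E(G)) := fun S =>
    {F | F.card ≤ S.card ∧ θ ^ 2 * ∑ e ∈ F, R.load S e ≤ S.card}
  have hsub : {ω : SampleSpace G α | ¬ R.SampleGood θ ω} ⊆
      ⋃ S ∈ (Finset.univ.filter fun S : Finset (V(G) × V(G)) => S.Nonempty),
        ⋃ F ∈ Φ S, B S F := by
    intro ω hω
    simp only [Set.mem_ofPred_eq, SampleGood] at hω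
    push Not at hω
    obtain ⟨S, hS, F, hF1, hF2, hF3⟩ := hω
    simp only [Set.mem_iUnion]
    exact ⟨S, by simp [hS], F, by simp [Φ, hF1, hF2], hF3⟩
  refine (measureReal_mono hsub (measure_ne_top _ _)).trans
    ((measureReal_biUnion_finset_le _ _).trans ?_)
  have hcard : Fintype.card (V(G) × V(G)) = Fintype.card V(G) ^ 2 := by
    rw [Fintype.card_prod, sq]
  have h3 := sum_pow_card_filter_nonempty_le (ι := V(G) × V(G)) hr0
    (by rw [hcard]; exact_mod_cast h)
  rw [hcard] at h3
  push_cast at h3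
  refine le_trans (Finset.sum_le_sum fun S _ => ?_) h3
  refine (measureReal_biUnion_finset_le _ _).trans ?_
  calc ∑ F ∈ Φ S, (R.sampleLaw α).real (B S F)
      ≤ ∑ F ∈ Φ S, ((Real.exp 1 / θ) ^ α) ^ S.card :=
        Finset.sum_le_sum fun F hF => R.sampleLaw_hits_le α hθ S F (Finset.mem_filter.1 hF).2.2
    _ = (Φ S).card * ((Real.exp 1 / θ) ^ α) ^ S.card := by simp
    _ ≤ ((Fintype.card E(G) + 1) ^ S.card : ℕ) * ((Real.exp 1 / θ) ^ α) ^ S.card := by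
        gcongr
        refine (Finset.card_le_card ?_).trans (card_finset_card_le S.card)
        intro F hF
        exact Finset.mem_filter.2 ⟨Finset.mem_univ _, (Finset.mem_filter.1 hF).2.1⟩
    _ = ((Fintype.card E(G) + 1) * (Real.exp 1 / θ) ^ α) ^ S.card := by
        push_cast
        rw [mul_pow]
    _ ≤ r ^ S.card := by gcongr

end Routing

/-! ### Routing sets of unit demands through a good sample. -/

theorem card_filter_draws {α : ℕ} (S : Finset (V(G) × V(G))) (p : V(G) × V(G) × Fin α → Prop)
    [DecidablePred p] :
    ((draws α S).filter p).card =
      ∑ st ∈ S, (Finset.univ.filter fun i => p (st.1, st.2, i)).card := by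
  simp only [Finset.card_filter, sum_draws]

namespace Routing

/-- The fraction of the draws with indices in `I st` whose path uses the edge `e`. -/
noncomputable def useFraction {α : ℕ} (ω : SampleSpace G α) (I : V(G) × V(G) → Finset (Fin α))
    (e : E) (st : V(G) × V(G)) : ℝ :=
  ((I st).filter fun i => (ω (st.1, st.2, i)).Uses e).card / (I st).card

theorem useFraction_nonneg {α : ℕ} (ω : SampleSpace G α) (I : V(G) × V(G) → Finset (Fin α))
    (e : E) (st : V(G) × V(G)) : 0 ≤ useFraction ω I e st := by
  unfold useFraction
  positivity

theorem useFraction_le_one {α : ℕ} (ω : SampleSpace G α) (I : V(G) × V(G) → Finset (Fin α))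
    (e : E) (st : V(G) × V(G)) : useFraction ω I e st ≤ 1 :=
  div_le_one_of_le₀ (by exact_mod_cast Finset.card_filter_le _ _) (Nat.cast_nonneg _)

theorem SampleGood.exists_third_routable [Fintype E(G)] {R : G.Routing} {α : ℕ} {θ c : ℝ}
    {ω : SampleSpace G α} (h : R.SampleGood θ ω) (hα : 1 ≤ α) (hθ : 1 ≤ θ) (hc : 1 ≤ c)
    {S : Finset (V(G) × V(G))} (hS : S.Nonempty) (hload : ∀ e : E(G), R.load S e ≤ c) :
    ∃ (S₁ : Finset (V(G) × V(G))) (I : V(G) × V(G) → Finset (Fin α)), S₁ ⊆ S ∧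
      (∀ st ∈ S₁, (I st).Nonempty) ∧ 3 * (S \ S₁).card ≤ 2 * S.card ∧
      ∀ e : E(G), ∑ st ∈ S₁, useFraction ω I e st ≤ 4 * θ ^ 2 * c := by
  have hα' : (0 : ℝ) < α := by exact_mod_cast hα
  have hθ2 : 1 ≤ θ ^ 2 := one_le_pow₀ hθ
  have hθc : 1 ≤ θ ^ 2 * c := one_le_mul_of_one_le_of_one_le hθ2 hc
  obtain ⟨F, hF, hrest⟩ := exists_overloaded_finset (draws α S)
    (fun j (e : E(G)) => (ω j).Uses (e : E)) (τ := θ ^ 2 * c * α) (by positivity)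
  have hFS : θ ^ 2 * c * F.card ≤ S.card := by
    have h1 : θ ^ 2 * c * α * F.card ≤ S.card * α := by
      refine hF.trans ?_
      rw [← Nat.cast_mul, ← card_draws]
      exact_mod_cast Finset.card_filter_le _ _
    refine le_of_mul_le_mul_right ?_ hα'
    linarith
  have hFcard : F.card ≤ S.card := by
    have : (F.card : ℝ) ≤ S.card := by nlinarith [(Nat.cast_nonneg F.card : (0 : ℝ) ≤ _)]
    exact_mod_cast this
  have hFload : θ ^ 2 * ∑ e ∈ F, R.load S e ≤ S.card := by
    have h1 : ∑ e ∈ F, R.load S (e : E) ≤ F.card * c := by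
      rw [← nsmul_eq_mul]
      exact Finset.sum_le_card_nsmul _ _ _ fun e _ => hload e
    nlinarith
  have hhalf := h S hS F hFcard hFload
  let I : V(G) × V(G) → Finset (Fin α) := fun st =>
    {i | ¬ ∃ e ∈ F, (ω (st.1, st.2, i)).Uses (e : E)}
  have hsum : (∑ st ∈ S, (I st).card) +
      ((draws α S).filter fun j => ∃ e ∈ F, (ω j).Uses (e : E)).card = S.card * α := by
    rw [← card_draws, add_comm, ← Finset.card_filter_add_card_filter_not
      (s := draws α S) (fun j => ∃ e ∈ F, (ω j).Uses (e : E))]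
    congr 1
    rw [card_filter_draws]
  rw [card_draws] at hhalf
  -- More than half of all draws avoid `F`. Pairs outside `S₁` keep under a quarter each and the
  -- others at most all, so `S₁` contains at least a third of `S`.
  let S₁ := S.filter fun st => α ≤ 4 * (I st).card
  refine ⟨S₁, I, Finset.filter_subset _ _, ?_, ?_, ?_⟩
  · intro st hst
    have := (Finset.mem_filter.1 hst).2
    exact Finset.card_pos.1 (by omega)
  · have hsplit := Finset.sum_sdiff (f := fun st => (I st).card) (Finset.filter_subset
      (fun st => α ≤ 4 * (I st).card) S)
    have hcard := Finset.card_sdiff_add_card_eq_card (Finset.filter_subset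
      (fun st => α ≤ 4 * (I st).card) S)
    have h1 : ∑ st ∈ S₁, (I st).card ≤ S₁.card * α := by
      rw [← smul_eq_mul]
      refine Finset.sum_le_card_nsmul _ _ _ fun st _ => ?_
      simpa using Finset.card_le_univ (I st)
    have h2 : 4 * ∑ st ∈ S \ S₁, (I st).card ≤ (S \ S₁).card * α := by
      rw [← smul_eq_mul _ α, Finset.mul_sum]
      refine Finset.sum_le_card_nsmul _ _ _ fun st hst => ?_
      simp only [S₁, Finset.mem_sdiff, Finset.mem_filter, not_and, not_le] at hst
      exact (hst.2 hst.1).le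
    change ∑ st ∈ S \ S₁, _ + ∑ st ∈ S₁, _ = _ at hsplit
    change (S \ S₁).card + S₁.card = _ at hcard
    refine Nat.le_of_mul_le_mul_right ?_ (show 0 < α by omega)
    nlinarith
  · intro e
    have h1 : ∀ st ∈ S₁, useFraction ω I e st ≤
        4 / α * (Finset.univ.filter fun i => (¬ ∃ e ∈ F, (ω (st.1, st.2, i)).Uses (e : E)) ∧
          (ω (st.1, st.2, i)).Uses (e : E)).card := by
      intro st hst
      have h2 : (α : ℝ) ≤ 4 * (I st).card := by exact_mod_cast (Finset.mem_filter.1 hst).2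
      have h3 : (I st).filter (fun i => (ω (st.1, st.2, i)).Uses (e : E)) =
          (Finset.univ.filter fun i => (¬ ∃ e ∈ F, (ω (st.1, st.2, i)).Uses (e : E)) ∧
            (ω (st.1, st.2, i)).Uses (e : E)) := by
        rw [Finset.filter_filter]
      rw [useFraction, h3, div_eq_mul_inv, mul_comm]
      gcongr
      rw [inv_le_comm₀ (by linarith) (by positivity), inv_div]
      linarith
    refine (Finset.sum_le_sum h1).trans ?_
    rw [← Finset.mul_sum]
    have h4 := hrest e
    rw [card_filter_draws] at h4
    push_cast at h4
    calc _ ≤ 4 / (α : ℝ) * (θ ^ 2 * c * α) := by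
          refine mul_le_mul_of_nonneg_left (le_trans ?_ h4.le) (by positivity)
          exact Finset.sum_le_sum_of_subset_of_nonneg (Finset.filter_subset _ _)
            fun _ _ _ => Nat.cast_nonneg _
      _ = _ := by field_simp

theorem load_mono (R : G.Routing) {S T : Finset (V(G) × V(G))} (h : S ⊆ T) (e : E) :
    R.load S e ≤ R.load T e :=
  Finset.sum_le_sum_of_subset_of_nonneg h fun _ _ _ => R.probUses_nonneg _ _ _

/-- Each round leaves at most two thirds of the pairs, so `(2/3)^l |S| < 1` means that `l` rounds
exhaust `S`. Loads of subsets do not grow, so `c` serves in every round. -/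
theorem SampleGood.exists_useFraction_le [Fintype E(G)] {R : G.Routing} {α : ℕ} {θ c : ℝ}
    {ω : SampleSpace G α} (h : R.SampleGood θ ω) (hα : 1 ≤ α) (hθ : 1 ≤ θ) (hc : 1 ≤ c) (l : ℕ)
    (S : Finset (V(G) × V(G))) (hS : 2 ^ l * S.card < 3 ^ l)
    (hload : ∀ e : E(G), R.load S e ≤ c) :
    ∃ I : V(G) × V(G) → Finset (Fin α), (∀ st, (I st).Nonempty) ∧
      ∀ e : E(G), ∑ st ∈ S, useFraction ω I e st ≤ l * (4 * θ ^ 2 * c) := by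
  have : Nonempty (Fin α) := ⟨⟨0, hα⟩⟩
  induction l generalizing S with
  | zero =>
    have hS0 : S = ∅ := by
      rw [← Finset.card_eq_zero]
      omega
    exact ⟨fun _ => Finset.univ, fun _ => Finset.univ_nonempty, by simp [hS0]⟩
  | succ l ih =>
    rcases S.eq_empty_or_nonempty with rfl | hne
    · refine ⟨fun _ => Finset.univ, fun _ => Finset.univ_nonempty, fun e => ?_⟩
      rw [Finset.sum_empty]
      positivity
    · obtain ⟨S₁, I₁, hsub, hI₁, hcard, hle⟩ := h.exists_third_routable hα hθ hc hne hload
      obtain ⟨I₂, hI₂, hle₂⟩ := ih (S \ S₁)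
        (by rw [pow_succ, pow_succ] at hS; linarith [Nat.mul_le_mul_left (2 ^ l) hcard])
        fun e => (R.load_mono Finset.sdiff_subset e).trans (hload e)
      refine ⟨fun st => if st ∈ S₁ then I₁ st else I₂ st, fun st => ?_, fun e => ?_⟩
      · dsimp only
        split_ifs with hst
        exacts [hI₁ st hst, hI₂ st]
      · rw [← Finset.sum_sdiff hsub]
        have h1 : ∑ st ∈ S \ S₁, useFraction ω (fun st => if st ∈ S₁ then I₁ st else I₂ st) e st =
            ∑ st ∈ S \ S₁, useFraction ω I₂ e st :=
          Finset.sum_congr rfl fun st hst => by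
            simp only [useFraction, if_neg (Finset.mem_sdiff.1 hst).2]
        have h2 : ∑ st ∈ S₁, useFraction ω (fun st => if st ∈ S₁ then I₁ st else I₂ st) e st =
            ∑ st ∈ S₁, useFraction ω I₁ e st :=
          Finset.sum_congr rfl fun st hst => by simp only [useFraction, if_pos hst]
        rw [h1, h2]
        push_cast
        linarith [hle e, hle₂ e]

/-! ### Weighted demands by dyadic classes. -/

/-- The bound for arbitrary weights, by splitting the pairs into dyadic weight classes. -/
theorem SampleGood.exists_sum_mul_useFraction_le [Fintype V(G)] [Fintype E(G)] {R : G.Routing}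
    {α : ℕ} {θ : ℝ} {ω : SampleSpace G α} (h : R.SampleGood θ ω) (hα : 1 ≤ α) (hθ : 1 ≤ θ)
    {l q : ℕ} (hl : 2 ^ l * Fintype.card V(G) ^ 2 < 3 ^ l)
    (hq : Fintype.card V(G) ^ 2 ≤ 2 ^ q) (w : V(G) × V(G) → ℝ) {M L : ℝ} (hM : 0 < M) (hL : 0 ≤ L)
    (hw0 : ∀ st, 0 ≤ w st) (hwM : ∀ st, w st ≤ M)
    (hload : ∀ e : E(G), ∑ st, w st * R.probUses st.1 st.2 e ≤ L) :
    ∃ I : V(G) × V(G) → Finset (Fin α), (∀ st, (I st).Nonempty) ∧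
      ∀ e : E(G), ∑ st, w st * useFraction ω I e st ≤
        q * (l * (4 * θ ^ 2 * (2 * L + M))) + M := by
  let b : V(G) × V(G) → ℕ := fun st => Nat.findGreatest (fun i => w st ≤ M / 2 ^ i) q
  have hbq : ∀ st, b st ≤ q := fun st => Nat.findGreatest_le _
  have hb1 : ∀ st, w st ≤ M / 2 ^ b st := fun st =>
    Nat.findGreatest_spec (P := fun i => w st ≤ M / 2 ^ i) (Nat.zero_le q) (by simpa using hwM st)
  have hb2 : ∀ st, b st < q → M / 2 ^ (b st + 1) < w st := fun st hst =>
    not_le.1 (Nat.findGreatest_is_greatest (P := fun i => w st ≤ M / 2 ^ i) (Nat.lt_succ_self _) hst)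
  let S : ℕ → Finset (V(G) × V(G)) := fun i => {st | b st = i}
  have hScard : ∀ i, (S i).card ≤ Fintype.card V(G) ^ 2 := fun i =>
    (Finset.card_le_univ _).trans (by rw [Fintype.card_prod, sq])
  -- The summand `1` secures the requirement `1 ≤ c`; scaled back by `M / 2^i` it costs only `M /
  -- 2^i`.
  have hSload : ∀ i < q, ∀ e : E(G), R.load (S i) e ≤ 1 + 2 ^ (i + 1) / M * L := by
    intro i hi e
    have h1 : M / 2 ^ (i + 1) * R.load (S i) e ≤ L := by
      refine le_trans ?_ (hload e)
      rw [load, Finset.mul_sum]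
      refine (Finset.sum_le_sum fun st hst => ?_).trans
        (Finset.sum_le_sum_of_subset_of_nonneg (Finset.subset_univ (S i))
          fun st _ _ => mul_nonneg (hw0 st) (R.probUses_nonneg _ _ _))
      have hst : b st = i := (Finset.mem_filter.1 hst).2
      exact mul_le_mul_of_nonneg_right (hst ▸ hb2 st (hst ▸ hi)).le (R.probUses_nonneg _ _ _)
    have h2 : R.load (S i) e = 2 ^ (i + 1) / M * (M / 2 ^ (i + 1) * R.load (S i) e) := by
      field_simp
    rw [h2]
    have : 0 ≤ 2 ^ (i + 1) / M := by positivity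
    nlinarith
  have hI : ∀ i, ∃ I : V(G) × V(G) → Finset (Fin α), (∀ st, (I st).Nonempty) ∧ (i < q →
      ∀ e : E(G), ∑ st ∈ S i, useFraction ω I e st ≤
        l * (4 * θ ^ 2 * (1 + 2 ^ (i + 1) / M * L))) := by
    intro i
    by_cases hi : i < q
    · obtain ⟨I, hI1, hI2⟩ := h.exists_useFraction_le hα hθ
        (c := 1 + 2 ^ (i + 1) / M * L) (le_add_of_nonneg_right (by positivity)) l (S i)
        ((Nat.mul_le_mul_left _ (hScard i)).trans_lt hl) (hSload i hi)
      exact ⟨I, hI1, fun _ => hI2⟩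
    · exact ⟨fun _ => Finset.univ, fun _ => ⟨⟨0, hα⟩, Finset.mem_univ _⟩, fun hi' => absurd hi' hi⟩
  choose I hI1 hI2 using hI
  refine ⟨fun st => I (b st) st, fun st => hI1 _ st, fun e => ?_⟩
  rw [← Finset.sum_fiberwise_of_maps_to (s := Finset.univ) (t := Finset.range (q + 1)) (g := b)
    fun st _ => Finset.mem_range.2 (Nat.lt_succ_of_le (hbq st)), Finset.sum_range_succ]
  have hfrac : ∀ i, ∀ st ∈ S i, w st * useFraction ω (fun st => I (b st) st) e st ≤
      M / 2 ^ i * useFraction ω (I i) e st := by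
    intro i st hst
    have hst : b st = i := (Finset.mem_filter.1 hst).2
    have : useFraction ω (fun st => I (b st) st) (e : E) st = useFraction ω (I i) e st := by
      simp only [useFraction, hst]
    rw [this]
    exact mul_le_mul_of_nonneg_right (hst ▸ hb1 st) (useFraction_nonneg _ _ _ _)
  refine add_le_add ?_ ?_
  · rw [← nsmul_eq_mul]
    refine (Finset.sum_le_card_nsmul _ _ (l * (4 * θ ^ 2 * (2 * L + M))) fun i hi => ?_).trans
      (by simp)
    have hi : i < q := Finset.mem_range.1 hi
    refine (Finset.sum_le_sum (hfrac i)).trans ?_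
    rw [← Finset.mul_sum]
    calc _ ≤ M / 2 ^ i * (l * (4 * θ ^ 2 * (1 + 2 ^ (i + 1) / M * L))) :=
          mul_le_mul_of_nonneg_left (hI2 i hi e) (by positivity)
      _ = l * (4 * θ ^ 2 * (2 * L + M / 2 ^ i)) := by
          rw [pow_succ]
          field_simp
          ring
      _ ≤ _ := by
          gcongr
          exact div_le_self hM.le (one_le_pow₀ (by norm_num))
  -- The last class has no lower bound on its weights, but at most `2^q` pairs of weight at most `M
  -- / 2^q` load an edge by at most `M` in total.
  · refine (Finset.sum_le_sum (hfrac q)).trans ?_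
    calc _ ≤ ∑ _st ∈ S q, M / 2 ^ q :=
          Finset.sum_le_sum fun st _ =>
            mul_le_of_le_one_right (by positivity) (useFraction_le_one _ _ _ _)
      _ = (S q).card * (M / 2 ^ q) := by simp
      _ ≤ 2 ^ q * (M / 2 ^ q) := by
          gcongr
          exact_mod_cast (hScard q).trans hq
      _ = M := by field_simp

/-! ### From index sets to routings and congestion bounds. -/

/-- The routing that picks one of the draws with indices in `I (s, t)` uniformly. -/
noncomputable def ofSampleIndices {α : ℕ} (ω : SampleSpace G α)
    (I : V(G) × V(G) → Finset (Fin α)) (hI : ∀ st, (I st).Nonempty) : G.Routing :=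
  fun s t => (PMF.uniformOfFinset (I (s, t)) (hI _)).map fun i => ω (s, t, i)

theorem supportedOn_ofSampleIndices {α : ℕ} (ω : SampleSpace G α)
    (I : V(G) × V(G) → Finset (Fin α)) (hI : ∀ st, (I st).Nonempty) :
    (ofSampleIndices ω I hI).SupportedOn (PathSystem.ofSample ω) := by
  intro s t p hp
  rw [ofSampleIndices, PMF.support_map] at hp
  obtain ⟨i, -, rfl⟩ := hp
  exact ⟨i, rfl⟩

theorem probUses_ofSampleIndices {α : ℕ} (ω : SampleSpace G α)
    (I : V(G) × V(G) → Finset (Fin α)) (hI : ∀ st, (I st).Nonempty) (s t : V(G)) (e : E) :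
    (ofSampleIndices ω I hI).probUses s t e = useFraction ω I e (s, t) := by
  rw [probUses, ofSampleIndices, measureReal_def, PMF.toMeasure_map_apply _ _ _
    (measurable_of_finite _)
    (MeasurableSpace.measurableSet_top), PMF.toMeasure_uniformOfFinset_apply _ _
    (Set.toFinite _).measurableSet, ENNReal.toReal_div, ENNReal.toReal_natCast,
    ENNReal.toReal_natCast, useFraction]
  congr!

theorem edgeCong_eq_sum [Fintype V(G)] (R : G.Routing) (d : G.Demand) (e : E) :
    R.edgeCong d e = ∑ st : V(G) × V(G), d.val st.1 st.2 * R.probUses st.1 st.2 e := by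
  rw [edgeCong, Fintype.sum_prod_type]

theorem edgeCong_le_cong [Fintype V(G)] [Fintype E(G)] (R : G.Routing) (d : G.Demand)
    (e : E(G)) : R.edgeCong d e ≤ R.cong d :=
  le_ciSup (f := fun e : E(G) => R.edgeCong d (e : E)) (Set.finite_range _).bddAbove e

theorem cong_nonneg [Fintype V(G)] (R : G.Routing) (d : G.Demand) : 0 ≤ R.cong d :=
  Real.iSup_nonneg fun _ => Finset.sum_nonneg fun s _ => Finset.sum_nonneg fun t _ =>
    mul_nonneg (d.nonneg s t) (R.probUses_nonneg s t _)

end Routing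

theorem Demand.val_le_maxEntry [Fintype V(G)] (d : G.Demand) (s t : V(G)) :
    d.val s t ≤ d.maxEntry :=
  le_ciSup (f := fun st : V(G) × V(G) => d.val st.1 st.2) (Set.finite_range _).bddAbove (s, t)

theorem Demand.maxEntry_nonneg (d : G.Demand) : 0 ≤ d.maxEntry :=
  Real.iSup_nonneg fun st => d.nonneg st.1 st.2

open Routing

theorem PathSystem.cong_ofSample_le [Fintype V(G)] {α : ℕ} (ω : SampleSpace G α) (d : G.Demand)
    {D : ℝ} (hD : 0 ≤ D) (h : ∃ I : V(G) × V(G) → Finset (Fin α), (∀ st, (I st).Nonempty) ∧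
      ∀ e : E(G), ∑ st, d.val st.1 st.2 * useFraction ω I e st ≤ D) :
    (PathSystem.ofSample ω).cong d ≤ ENNReal.ofReal D := by
  obtain ⟨I, hI, hle⟩ := h
  refine (iInf₂_le (ofSampleIndices ω I hI) (supportedOn_ofSampleIndices ω I hI)).trans
    (ENNReal.ofReal_le_ofReal (Real.iSup_le (fun e => ?_) hD))
  rw [edgeCong_eq_sum]
  simp only [probUses_ofSampleIndices]
  exact hle e

variable [Fintype V(G)] [Fintype E(G)] {R : G.Routing} {α : ℕ} {θ : ℝ} {ω : SampleSpace G α}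

theorem Routing.SampleGood.cong_le_of_isZeroOne (h : R.SampleGood θ ω) (hα : 1 ≤ α)
    (hθ : 1 ≤ θ) {l : ℕ} (hl : 2 ^ l * Fintype.card V(G) ^ 2 < 3 ^ l) (d : G.Demand)
    (hd : d.IsZeroOne) :
    (PathSystem.ofSample ω).cong d ≤
      ENNReal.ofReal (l * (4 * θ ^ 2 * (R.cong d + 1))) := by
  have hc := R.cong_nonneg d
  refine PathSystem.cong_ofSample_le ω d (by positivity) ?_
  let S : Finset (V(G) × V(G)) := {st | d.val st.1 st.2 = 1}
  have hS : ∀ g : V(G) × V(G) → ℝ, ∑ st, d.val st.1 st.2 * g st = ∑ st ∈ S, g st := by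
    intro g
    rw [Finset.sum_filter]
    refine Finset.sum_congr rfl fun st _ => ?_
    rcases hd st.1 st.2 with h0 | h1
    · simp [h0]
    · simp [h1]
  have hcard : S.card ≤ Fintype.card V(G) ^ 2 :=
    (Finset.card_le_univ _).trans (by rw [Fintype.card_prod, sq])
  obtain ⟨I, hI, hle⟩ := h.exists_useFraction_le hα hθ (c := R.cong d + 1) (by linarith) l S
    ((Nat.mul_le_mul_left _ hcard).trans_lt hl) fun e => by
      have := R.edgeCong_le_cong d e
      rw [edgeCong_eq_sum, hS fun st => R.probUses st.1 st.2 e] at this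
      rw [load]
      linarith
  exact ⟨I, hI, fun e => by rw [hS]; exact hle e⟩

theorem Routing.SampleGood.cong_le (h : R.SampleGood θ ω) (hα : 1 ≤ α)
    (hθ : 1 ≤ θ) {l q : ℕ} (hl : 2 ^ l * Fintype.card V(G) ^ 2 < 3 ^ l)
    (hq : Fintype.card V(G) ^ 2 ≤ 2 ^ q) (d : G.Demand) :
    (PathSystem.ofSample ω).cong d ≤ ENNReal.ofReal
      (q * (l * (4 * θ ^ 2 * (2 * R.cong d + d.maxEntry))) + d.maxEntry) := by
  have hc := R.cong_nonneg d
  have hM := d.maxEntry_nonneg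
  refine PathSystem.cong_ofSample_le ω d (by positivity) ?_
  rcases hM.eq_or_lt with hM0 | hM0
  · refine ⟨fun _ => Finset.univ, fun _ => ⟨⟨0, hα⟩, Finset.mem_univ _⟩, fun e => ?_⟩
    have hd : ∀ s t, d.val s t = 0 := fun s t =>
      le_antisymm (hM0 ▸ d.val_le_maxEntry s t) (d.nonneg s t)
    simp only [hd, zero_mul, Finset.sum_const_zero]
    positivity
  · exact h.exists_sum_mul_useFraction_le hα hθ hl hq (fun st => d.val st.1 st.2) hM0 hc
      (fun st => d.nonneg _ _) (fun st => d.val_le_maxEntry _ _)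
      fun e => by rw [← edgeCong_eq_sum]; exact R.edgeCong_le_cong d e

/-! ### Choice of constants and conclusion. -/

theorem add_one_mul_rpow_le {K k m n : ℕ} (hn : 2 ≤ n) (hm : m ≤ K * n ^ k) (c : ℝ) :
    ((m : ℝ) + 1) * (n : ℝ) ^ (-(c + K + k)) ≤ (n : ℝ) ^ (-c) := by
  have h1 : m + 1 ≤ n ^ (K + k) := by
    have h2 : K + 1 ≤ n ^ K := (Nat.lt_pow_self (by norm_num)).trans_le (Nat.pow_le_pow_left hn K)
    have h3 : 1 ≤ n ^ k := Nat.one_le_pow _ _ (by omega)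
    rw [pow_add]
    nlinarith
  have hn0 : (0 : ℝ) < n := by positivity
  have h4 : ((m : ℝ) + 1) ≤ (n : ℝ) ^ ((K : ℝ) + k) := by
    rw [← Nat.cast_add, Real.rpow_natCast]
    exact_mod_cast h1
  calc _ ≤ (n : ℝ) ^ ((K : ℝ) + k) * (n : ℝ) ^ (-(c + K + k)) := by gcongr
    _ = _ := by
      rw [← Real.rpow_add hn0]
      congr 1
      ring

theorem clog_le_two_mul_logb {n : ℕ} (hn : 2 ≤ n) :
    (Nat.clog 2 n : ℝ) ≤ 2 * Real.logb 2 n ∧ 1 ≤ Real.logb 2 n := by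
  have h1 : 1 ≤ Real.logb 2 n := by
    rw [Real.le_logb_iff_rpow_le (by norm_num) (by positivity)]
    simpa using (by exact_mod_cast hn : (2 : ℝ) ≤ n)
  have h2 : ((Nat.clog 2 n).pred : ℝ) ≤ Real.logb 2 n := by
    rw [Real.le_logb_iff_rpow_le (by norm_num) (by positivity), Real.rpow_natCast]
    exact_mod_cast (Nat.pow_pred_clog_lt_self (by norm_num) (by omega)).le
  have h3 : (Nat.clog 2 n : ℝ) ≤ (Nat.clog 2 n).pred + 1 := by
    exact_mod_cast (show Nat.clog 2 n ≤ (Nat.clog 2 n).pred + 1 by rw [Nat.pred_eq_sub_one]; omega)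
  exact ⟨by linarith, h1⟩

end Graph

end

theorem mainTheorem3 (K k : ℕ) (C : ℝ) (hC : 0 < C) :
    ∃ A B : ℝ, 0 < A ∧ 0 < B ∧
      ∀ (V : Type*) (E : Type*) (G : Graph V E) [Fintype V(G)] [Fintype E(G)] (n : ℕ),
        G.IsConnected →
        Fintype.card V(G) = n →
        Fintype.card E(G) ≤ K * n ^ k →
        ∀ (R : G.Routing) (α : ℕ), 1 ≤ α → α ≤ n →
          ENNReal.ofReal (1 - (n : ℝ) ^ (-C)) ≤
            R.sampleLaw α {ω : Graph.Routing.SampleSpace G α |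
              (∀ d : G.Demand,
                (Graph.PathSystem.ofSample ω).cong d ≤
                  ENNReal.ofReal
                    (A * (Real.logb 2 n ^ 2 * ((α : ℝ) + (n : ℝ) ^ (B / (α : ℝ)))) *
                      (R.cong d + d.maxEntry))) ∧
              (∀ d : G.Demand, d.IsZeroOne →
                (Graph.PathSystem.ofSample ω).cong d ≤
                  ENNReal.ofReal
                    (A * (Real.logb 2 n * ((α : ℝ) + (n : ℝ) ^ (B / (α : ℝ)))) *
                      (R.cong d + 1)))} := by
  -- `K + k` pays for the `|E|+1` edge choices, `2` for the `n²` pairs, and `1` for the factor `2 ≤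
  -- n` of the union bound. `B = 2b` because `θ² = e²·n^(2b/α)`; `257` is `256` from the dyadic
  -- classes plus `1` for the lone `maxEntry` term.
  let b : ℝ := C + 3 + K + k
  have hb : 0 < b := by positivity
  refine ⟨257 * Real.exp 1 ^ 2, 2 * b, by positivity, by positivity, ?_⟩
  intro V E G _ _ n _ hcard hm R α hα hαn
  have hn1 : 1 ≤ n := hα.trans hαn
  rcases hn1.eq_or_lt with rfl | hn
  -- For `n = 1` the claimed probability is `0`.
  · simp
  have hn2 : (2 : ℝ) ≤ n := by exact_mod_cast hn
  have hn0 : (0 : ℝ) < n := by linarith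
  have hα0 : (0 : ℝ) < α := by exact_mod_cast hα
  have : IsProbabilityMeasure (R.sampleLaw α) := by unfold Graph.Routing.sampleLaw; infer_instance
  let y : ℝ := (n : ℝ) ^ (2 * b / α)
  let θ : ℝ := Real.exp 1 * (n : ℝ) ^ (b / α)
  have hy : 1 ≤ y := Real.one_le_rpow (by linarith) (by positivity)
  have hθy : θ ^ 2 = Real.exp 1 ^ 2 * y := by
    rw [mul_pow, ← Real.rpow_natCast ((n : ℝ) ^ (b / α)), ← Real.rpow_mul hn0.le]
    congr 2
    push_cast
    ring
  have he : 1 ≤ Real.exp 1 := Real.one_le_exp (by norm_num)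
  have hθ : 1 ≤ θ := one_le_mul_of_one_le_of_one_le he
    (Real.one_le_rpow (by linarith) (by positivity))
  have hρ : (Real.exp 1 / θ) ^ α = (n : ℝ) ^ (-b) := by
    have h1 : Real.exp 1 / θ = (n : ℝ) ^ (-(b / α)) := by
      rw [Real.rpow_neg hn0.le]
      simp only [θ]
      field_simp
    rw [h1, ← Real.rpow_natCast, ← Real.rpow_mul hn0.le]
    congr 1
    field_simp
  have hr : ((Fintype.card E(G) : ℝ) + 1) * (Real.exp 1 / θ) ^ α ≤ (n : ℝ) ^ (-(C + 3)) := by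
    rw [hρ]
    exact Graph.add_one_mul_rpow_le hn hm (C + 3)
  have hnr : (n : ℝ) ^ 2 * (n : ℝ) ^ (-(C + 3)) = (n : ℝ) ^ (-C) / n := by
    rw [← Real.rpow_natCast, ← Real.rpow_add hn0, ← Real.rpow_sub_one hn0.ne']
    congr 1
    push_cast
    ring
  have hnC : (n : ℝ) ^ (-C) ≤ 1 := Real.rpow_le_one_of_one_le_of_nonpos (by linarith) (by linarith)
  have hnC0 : 0 < (n : ℝ) ^ (-C) := by positivity
  have hbad := R.sampleLaw_not_sampleGood_le α hθ hr (by
    rw [hcard, hnr, div_le_one hn0]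
    linarith)
  have hbad' : (R.sampleLaw α).real {ω | ¬ R.SampleGood θ ω} ≤ (n : ℝ) ^ (-C) := by
    refine hbad.trans ?_
    rw [hcard, hnr, ← mul_div_assoc, div_le_iff₀ hn0]
    nlinarith
  have hgood : 1 - (n : ℝ) ^ (-C) ≤ (R.sampleLaw α).real {ω | R.SampleGood θ ω} := by
    -- Subadditivity suffices here, so measurability of the good event is not needed.
    have h1 := measureReal_union_le (μ := R.sampleLaw α) {ω | R.SampleGood θ ω}
      {ω | ¬ R.SampleGood θ ω}
    have h2 : {ω : Graph.Routing.SampleSpace G α | R.SampleGood θ ω} ∪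
        {ω | ¬ R.SampleGood θ ω} = Set.univ := by
      ext ω
      simpa using em (R.SampleGood θ ω)
    rw [h2, probReal_univ] at h1
    linarith
  refine (ENNReal.ofReal_le_iff_le_toReal (measure_ne_top _ _)).2
    (hgood.trans (measureReal_mono ?_ (measure_ne_top _ _)))
  obtain ⟨hq, hlog⟩ := Graph.clog_le_two_mul_logb hn
  have hpow : n ≤ 2 ^ Nat.clog 2 n := Nat.le_pow_clog (by norm_num) n
  have hpos : 0 < Nat.clog 2 n := Nat.clog_pos (by norm_num) hn
  set q := Nat.clog 2 n
  set lg := Real.logb 2 n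
  have hn4 : n ^ 2 ≤ 2 ^ (2 * q) := by
    rw [mul_comm, pow_mul]
    exact Nat.pow_le_pow_left hpow 2
  -- `4q` rounds suffice because `n² ≤ 4^q` and `16·4 < 81`.
  have hl : 2 ^ (4 * q) * Fintype.card V(G) ^ 2 < 3 ^ (4 * q) := by
    rw [hcard]
    calc 2 ^ (4 * q) * n ^ 2 ≤ 2 ^ (4 * q) * 2 ^ (2 * q) := Nat.mul_le_mul_left _ hn4
      _ = 64 ^ q := by
        rw [← pow_add, ← add_mul, pow_mul]
        norm_num
      _ < 81 ^ q := Nat.pow_lt_pow_left (by norm_num) hpos.ne'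
      _ = 3 ^ (4 * q) := by
        rw [pow_mul]
        norm_num
  intro ω hω
  have hω : R.SampleGood θ ω := hω
  refine ⟨fun d => (hω.cong_le hα hθ hl (hcard ▸ hn4) d).trans (ENNReal.ofReal_le_ofReal ?_),
    fun d hd => (hω.cong_le_of_isZeroOne hα hθ hl d hd).trans (ENNReal.ofReal_le_ofReal ?_)⟩
  · have hc := R.cong_nonneg d
    have hM := d.maxEntry_nonneg
    rw [hθy]
    push_cast
    have hone : 1 ≤ Real.exp 1 ^ 2 * (lg ^ 2 * y) :=
      one_le_mul_of_one_le_of_one_le (one_le_pow₀ he)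
        (one_le_mul_of_one_le_of_one_le (one_le_pow₀ hlog) hy)
    calc 2 * (q : ℝ) * (4 * q * (4 * (Real.exp 1 ^ 2 * y) * (2 * R.cong d + d.maxEntry))) +
          d.maxEntry
        ≤ 2 * (2 * lg) * (4 * (2 * lg) * (4 * (Real.exp 1 ^ 2 * y) *
          (2 * R.cong d + 2 * d.maxEntry))) +
          Real.exp 1 ^ 2 * (lg ^ 2 * y) * (R.cong d + d.maxEntry) := by
          refine add_le_add ?_ ?_
          · gcongr
            linarith
          · nlinarith
      _ = 257 * Real.exp 1 ^ 2 * (lg ^ 2 * y) * (R.cong d + d.maxEntry) := by ring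
      -- The term `α` in the bound is pure slack: `n^(B/α)` alone suffices.
      _ ≤ _ := by
          gcongr
          exact le_add_of_nonneg_left hα0.le
  · have hc := R.cong_nonneg d
    rw [hθy]
    push_cast
    calc 4 * (q : ℝ) * (4 * (Real.exp 1 ^ 2 * y) * (R.cong d + 1))
        ≤ 4 * (2 * lg) * (4 * (Real.exp 1 ^ 2 * y) * (R.cong d + 1)) := by gcongr
      _ = 32 * Real.exp 1 ^ 2 * (lg * y) * (R.cong d + 1) := by ring
      _ ≤ _ := by
          gcongr
          · norm_num
          · exact le_add_of_nonneg_left hα0.le
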